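/- **Theorem B.** Let $N_4$ be the group of $4\times 4$ lower triangular matrices with integer entries and all diagonal entries equal to $1$. For $\alpha\ge 0$ let $\mathrm{Diff}_+^{1+\alpha}([0,1])$ be the group (under composition) of orientation-preserving $C^1$ diffeomorphisms $f$ of $[0,1]$ whose derivative is $\alpha$-Hölder continuous, that is, for which there is $C>0$ with $|f'(x)-f'(y)|\le C|x-y|^{\alpha}$ for all $x,y\in[0,1]$. Then for every real number $\alpha>1/2$ the group $N_4$ does not embed into $\mathrm{Diff}_+^{1+\alpha}([0,1])$: there is no injective group homomorphism $N_4\to \mathrm{Diff}_+^{1+\alpha}([0,1])$. -/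

import Mathlib

open Set
open scoped NNReal unitInterval

/-- The group `N₄` of `4 × 4` lower triangular matrices with integer entries and `1` on the
diagonal (such matrices have determinant `1`, so they are units of the matrix ring). -/
def N4 : Subgroup (Matrix (Fin 4) (Fin 4) ℤ)ˣ where
  carrier := {A | (∀ i, A.1 i i = 1) ∧ ∀ i j, i < j → A.1 i j = 0}
  one_mem' := by
    refine ⟨fun i => by simp, fun i j h => ?_⟩
    simp [Matrix.one_apply_ne h.ne]
  mul_mem' := by
    rintro A B ⟨hA, hA'⟩ ⟨hB, hB'⟩
    refine ⟨fun i => ?_, fun i j h => ?_⟩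
    · rw [Units.val_mul, Matrix.mul_apply, Finset.sum_eq_single i]
      · rw [hA, hB, one_mul]
      · intro k _ hk
        rcases lt_or_gt_of_ne hk with h | h
        · rw [hB' k i h, mul_zero]
        · rw [hA' i k h, zero_mul]
      · simp
    · rw [Units.val_mul, Matrix.mul_apply]
      refine Finset.sum_eq_zero fun k _ => ?_
      rcases lt_or_ge i k with h1 | h1
      · rw [hA' i k h1, zero_mul]
      · rw [hB' k j (h1.trans_lt h), mul_zero]
  inv_mem' := by
    rintro A ⟨hA, hA'⟩
    have key : ∀ i j, i ≤ j → (A⁻¹).1 i j = if i = j then 1 else 0 := by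
      intro i
      induction i using WellFoundedLT.induction with
      | ind i ih =>
        intro j hij
        have h1 : (A.1 * (A⁻¹).1) i j = if i = j then 1 else 0 := by
          rw [← Units.val_mul, mul_inv_cancel, Units.val_one, Matrix.one_apply]
        rw [← h1, Matrix.mul_apply, Finset.sum_eq_single i]
        · rw [hA, one_mul]
        · intro k _ hk
          rcases lt_or_gt_of_ne hk with h | h
          · rw [ih k h j (h.le.trans hij), if_neg (h.trans_le hij).ne, mul_zero]
          · rw [hA' i k h, zero_mul]
        · simp
    exact ⟨fun i => by rw [key i i le_rfl, if_pos rfl],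
      fun i j h => by rw [key i j h.le, if_neg h.ne]⟩

/-- Every integer lower triangular matrix with `1` on the diagonal belongs to `N₄`. -/
theorem exists_mem_N4 (M : Matrix (Fin 4) (Fin 4) ℤ) (h1 : ∀ i, M i i = 1)
    (h0 : ∀ i j, i < j → M i j = 0) : ∃ A ∈ N4, A.1 = M := by
  have hdet : M.det = 1 := by
    rw [Matrix.det_of_isLowerTriangular M (fun i j h => h0 i j h)]
    simp [h1]
  have hu : IsUnit M := (Matrix.isUnit_iff_isUnit_det M).2 (by simp [hdet])
  obtain ⟨A, rfl⟩ := hu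
  exact ⟨A, ⟨h1, h0⟩, rfl⟩

/-- A self-map of `[0,1]` seen as a real function: on `[0,1]` it is the given map, and it is
constant on either side of `[0,1]`. Only its values on `[0,1]` are ever used. -/
noncomputable def realExt (f : I ≃o I) (t : ℝ) : ℝ :=
  (f (projIcc 0 1 zero_le_one t) : ℝ)

/-- An increasing bijection `f` of `[0,1]` is a diffeomorphism of class `C^{1+α}`: both `f` and
`f⁻¹` are `C¹` on the closed interval `[0,1]` (one-sided derivatives at the end points), and the
derivative of `f` is `α`-Hölder on `[0,1]`. -/
def IsDiffHolder (α : ℝ≥0) (f : I ≃o I) : Prop :=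
  ContDiffOn ℝ 1 (realExt f) (Icc 0 1) ∧
  ContDiffOn ℝ 1 (realExt f.symm) (Icc 0 1) ∧
  ∃ C : ℝ≥0, HolderOnWith C α (derivWithin (realExt f) (Icc 0 1)) (Icc 0 1)

theorem realExt_mem (f : I ≃o I) (t : ℝ) : realExt f t ∈ Icc (0 : ℝ) 1 :=
  (f (projIcc 0 1 zero_le_one t)).2

theorem realExt_comp (f g : I ≃o I) : realExt f ∘ realExt g = realExt (f * g) := by
  ext t
  simp [realExt]

theorem realExt_one {t : ℝ} (ht : t ∈ Icc (0 : ℝ) 1) : realExt (1 : I ≃o I) t = t := by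
  simp [realExt, projIcc_of_mem _ ht]

theorem derivWithin_realExt_one {x : ℝ} (hx : x ∈ Icc (0 : ℝ) 1) :
    derivWithin (realExt (1 : I ≃o I)) (Icc 0 1) x = 1 := by
  have h := derivWithin_congr (𝕜 := ℝ) (f := fun t : ℝ => t) (f₁ := realExt (1 : I ≃o I))
    (fun t ht => realExt_one ht) (realExt_one hx)
  rw [h]
  exact derivWithin_id' _ _ (uniqueDiffOn_Icc zero_lt_one x hx)

theorem derivWithin_realExt_mul {f g : I ≃o I} (hf : ContDiffOn ℝ 1 (realExt f) (Icc 0 1))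
    (hg : ContDiffOn ℝ 1 (realExt g) (Icc 0 1)) {x : ℝ} (hx : x ∈ Icc (0 : ℝ) 1) :
    derivWithin (realExt (f * g)) (Icc 0 1) x =
      derivWithin (realExt f) (Icc 0 1) (realExt g x) * derivWithin (realExt g) (Icc 0 1) x := by
  rw [← realExt_comp]
  exact derivWithin_comp x (hf.differentiableOn one_ne_zero _ (realExt_mem g x))
    (hg.differentiableOn one_ne_zero _ hx) (fun t _ => realExt_mem g t)

theorem derivWithin_realExt_bound {f : I ≃o I} (hf : ContDiffOn ℝ 1 (realExt f) (Icc 0 1)) :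
    ∃ K : ℝ, 0 ≤ K ∧ (∀ x ∈ Icc (0 : ℝ) 1, |derivWithin (realExt f) (Icc 0 1) x| ≤ K) ∧
      ∀ x ∈ Icc (0 : ℝ) 1, ∀ y ∈ Icc (0 : ℝ) 1, |realExt f x - realExt f y| ≤ K * |x - y| := by
  have hc : ContinuousOn (derivWithin (realExt f) (Icc 0 1)) (Icc 0 1) :=
    hf.continuousOn_derivWithin (uniqueDiffOn_Icc zero_lt_one) le_rfl
  obtain ⟨K, hK⟩ := isCompact_Icc.exists_bound_of_continuousOn hc
  refine ⟨K, (norm_nonneg _).trans (hK 0 (by simp)), hK, fun x hx y hy => ?_⟩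
  exact (convex_Icc (0 : ℝ) 1).norm_image_sub_le_of_norm_derivWithin_le
    (hf.differentiableOn one_ne_zero) hK hy hx

theorem holderOnWith_iff_abs (α : ℝ≥0) (u : ℝ → ℝ) (s : Set ℝ) :
    (∃ C : ℝ≥0, HolderOnWith C α u s) ↔
      ∃ C : ℝ, ∀ x ∈ s, ∀ y ∈ s, |u x - u y| ≤ C * |x - y| ^ (α : ℝ) := by
  constructor
  · rintro ⟨C, hC⟩
    refine ⟨C, fun x hx y hy => ?_⟩
    have := hC.dist_le hx hy
    simpa [Real.dist_eq] using this
  · rintro ⟨C, hC⟩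
    refine ⟨C.toNNReal, fun x hx y hy => ?_⟩
    have h1 : dist (u x) (u y) ≤ (C.toNNReal : ℝ) * dist x y ^ (α : ℝ) := by
      rw [Real.dist_eq, Real.dist_eq]
      refine (hC x hx y hy).trans ?_
      gcongr
      exact Real.le_coe_toNNReal C
    have h2 : nndist (u x) (u y) ≤ C.toNNReal * nndist x y ^ (α : ℝ) := by
      rw [← NNReal.coe_le_coe]
      rw [NNReal.coe_mul, NNReal.coe_rpow]
      exact h1
    rw [edist_nndist, edist_nndist, ← ENNReal.coe_rpow_of_nonneg _ (NNReal.coe_nonneg α)]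
    exact_mod_cast h2

/-- `Diff₊^{1+α}([0,1])`: the group, under composition, of orientation-preserving
diffeomorphisms of `[0,1]` of class `C^{1+α}`. -/
def DiffPlus (α : ℝ≥0) : Subgroup (I ≃o I) where
  carrier := {f | IsDiffHolder α f}
  one_mem' := by
    have h : ContDiffOn ℝ 1 (realExt 1) (Icc 0 1) :=
      contDiffOn_id.congr fun t ht => realExt_one ht
    refine ⟨h, h, 0, fun x hx y hy => ?_⟩
    simp [derivWithin_realExt_one hx, derivWithin_realExt_one hy]
  mul_mem' := by
    rintro f g ⟨hf, hf', hfα⟩ ⟨hg, hg', hgα⟩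
    refine ⟨?_, ?_, ?_⟩
    · rw [← realExt_comp]
      exact hf.comp hg fun t _ => realExt_mem g t
    · change ContDiffOn ℝ 1 (realExt (g.symm * f.symm)) _
      rw [← realExt_comp]
      exact hg'.comp hf' fun t _ => realExt_mem f.symm t
    · rw [holderOnWith_iff_abs] at hfα hgα ⊢
      obtain ⟨A, hA⟩ := hfα
      obtain ⟨B, hB⟩ := hgα
      obtain ⟨K, hK0, hK, -⟩ := derivWithin_realExt_bound hf
      obtain ⟨L, hL0, hL, hL'⟩ := derivWithin_realExt_bound hg
      refine ⟨|A| * L ^ (α : ℝ) * L + K * B, fun x hx y hy => ?_⟩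
      rw [derivWithin_realExt_mul hf hg hx, derivWithin_realExt_mul hf hg hy]
      have h1 : |derivWithin (realExt f) (Icc 0 1) (realExt g x) -
          derivWithin (realExt f) (Icc 0 1) (realExt g y)| ≤
            |A| * (L ^ (α : ℝ) * |x - y| ^ (α : ℝ)) := by
        refine (hA _ (realExt_mem g x) _ (realExt_mem g y)).trans ?_
        rw [← Real.mul_rpow hL0 (abs_nonneg _)]
        gcongr
        · exact le_abs_self A
        · exact hL' x hx y hy
      have h2 := hL x hx
      have h3 := hK _ (realExt_mem g y)
      have h4 := hB x hx y hy
      generalize derivWithin (realExt f) (Icc 0 1) (realExt g x) = a at *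
      generalize derivWithin (realExt f) (Icc 0 1) (realExt g y) = b at *
      generalize derivWithin (realExt g) (Icc 0 1) x = c at *
      generalize derivWithin (realExt g) (Icc 0 1) y = d at *
      calc |a * c - b * d| = |(a - b) * c + b * (c - d)| := by ring_nf
        _ ≤ |a - b| * |c| + |b| * |c - d| := by
          rw [← abs_mul, ← abs_mul]; exact abs_add_le _ _
        _ ≤ (|A| * (L ^ (α : ℝ) * |x - y| ^ (α : ℝ))) * L + K * (B * |x - y| ^ (α : ℝ)) := by
          gcongr
        _ = _ := by ring
  inv_mem' := by
    rintro f ⟨hf, hf', hfα⟩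
    refine ⟨hf', hf, ?_⟩
    change ∃ C, HolderOnWith C α (derivWithin (realExt f.symm) (Icc 0 1)) (Icc 0 1)
    rw [holderOnWith_iff_abs] at hfα ⊢
    obtain ⟨A, hA⟩ := hfα
    obtain ⟨L, hL0, hL, hL'⟩ := derivWithin_realExt_bound hf'
    have hinv : ∀ x ∈ Icc (0 : ℝ) 1, derivWithin (realExt f) (Icc 0 1) (realExt f.symm x) *
        derivWithin (realExt f.symm) (Icc 0 1) x = 1 := fun x hx => by
      rw [← derivWithin_realExt_mul hf hf' hx]
      have h1 : f * f.symm = 1 := mul_inv_cancel f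
      rw [h1, derivWithin_realExt_one hx]
    refine ⟨L * L * (|A| * L ^ (α : ℝ)), fun x hx y hy => ?_⟩
    have h1 : |derivWithin (realExt f) (Icc 0 1) (realExt f.symm y) -
        derivWithin (realExt f) (Icc 0 1) (realExt f.symm x)| ≤
          |A| * (L ^ (α : ℝ) * |x - y| ^ (α : ℝ)) := by
      refine (hA _ (realExt_mem f.symm y) _ (realExt_mem f.symm x)).trans ?_
      rw [← Real.mul_rpow hL0 (abs_nonneg _), abs_sub_comm x y]
      gcongr
      · exact le_abs_self A
      · exact hL' y hy x hx
    have h2 := hL x hx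
    have h3 := hL y hy
    have h4 := hinv x hx
    have h5 := hinv y hy
    generalize derivWithin (realExt f) (Icc 0 1) (realExt f.symm x) = a at *
    generalize derivWithin (realExt f) (Icc 0 1) (realExt f.symm y) = b at *
    generalize derivWithin (realExt f.symm) (Icc 0 1) x = c at *
    generalize derivWithin (realExt f.symm) (Icc 0 1) y = d at *
    calc |c - d| = |c * d * (b - a)| := by
          congr 1; linear_combination d * h4 - c * h5
      _ = |c| * |d| * |b - a| := by rw [abs_mul, abs_mul]
      _ ≤ L * L * (|A| * (L ^ (α : ℝ) * |x - y| ^ (α : ℝ))) := by gcongr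
      _ = _ := by ring

/-! A generator `z` of the center would act nontrivially, so some component `(v, w)` of the
complement of its fixed points exists, and the whole group permutes such components.

Dynamics of the stabilizer: on `(v, w)` a commutator of n-th powers has displacement at most linear
in n, measured in steps of `z`, whereas a Heisenberg relation would make it quadratic. So the
stabilizer of `v` contains no Heisenberg pair (`false_of_commutator_eq_zpow`).

Dynamics of the orbit: suppose the intervals `s ^ i * t ^ j (v, w)` are pairwise disjoint, `t`
commutes with `u`, and `s`, `u` have a nontrivial central commutator. The lengths sum to at most 1,
and averaging over Pólya urn paths in the grid, which is where the exponent above 1/2 is needed,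
yields elements `g` with large `s`-exponent and bounded distortion on `(v, w)` and on its image
under `u` (`exists_bounded_distortion`). But `u * g = g * u * z ^ n` with `|n|` large, so `g` must
expand a tiny interval to a definite proportion of its image (`false_of_grid`).

Algebra: either a suitable grid exists or the stabilizer is so large that it contains a Heisenberg
pair (`CentralInterval.false`). -/

/-! ### Distortion of Hölder diffeomorphisms. -/

theorem realExt_coe (f : I ≃o I) (x : I) : realExt f x = f x := by
  simp [realExt]

/-- The slopes of `f` on subintervals of `[w, w']` differ from the slope on `[w, w']` at most by
the factor `exp c`. -/
def DistortionBound (f : I ≃o I) (w w' : I) (c : ℝ) : Prop :=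
  ∀ x y : I, w ≤ x → x ≤ y → y ≤ w' →
    ((f w' : ℝ) - f w) * (y - x) ≤ Real.exp c * (((f y : ℝ) - f x) * (w' - w)) ∧
    ((f y : ℝ) - f x) * (w' - w) ≤ Real.exp c * (((f w' : ℝ) - f w) * (y - x))

/-- The distortion of `f` on an interval is at most `exp (C * d ^ β)`, where `d` is the length of
the interval. -/
def HolderDistortion (β C : ℝ) (f : I ≃o I) : Prop :=
  ∀ w w' : I, w ≤ w' → DistortionBound f w w' (C * ((w' : ℝ) - w) ^ β)

theorem coe_sub_nonneg {x y : I} (h : x ≤ y) : (0 : ℝ) ≤ y - x := sub_nonneg.2 h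

theorem map_sub_nonneg (f : I ≃o I) {x y : I} (h : x ≤ y) : (0 : ℝ) ≤ f y - f x :=
  sub_nonneg.2 (f.monotone h)

theorem coe_sub_pos {x y : I} (h : x < y) : (0 : ℝ) < y - x := sub_pos.2 h

theorem coe_sub_le_one (x y : I) : (y : ℝ) - x ≤ 1 := by
  linarith [y.2.2, x.2.1]

theorem DistortionBound.mono {f : I ≃o I} {w w' : I} {c c' : ℝ} (h : DistortionBound f w w' c)
    (hc : c ≤ c') : DistortionBound f w w' c' := by
  intro x y h1 h2 h3
  have hw : w ≤ w' := h1.trans (h2.trans h3)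
  obtain ⟨ha, hb⟩ := h x y h1 h2 h3
  have p1 := map_sub_nonneg f hw
  have p2 := map_sub_nonneg f h2
  have p3 := coe_sub_nonneg hw
  have p4 := coe_sub_nonneg h2
  exact ⟨ha.trans (by gcongr), hb.trans (by gcongr)⟩

theorem DistortionBound.comp {f g : I ≃o I} {w w' : I} {c d : ℝ} (hw : w < w')
    (hf : DistortionBound f (g w) (g w') d) (hg : DistortionBound g w w' c) :
    DistortionBound (f * g) w w' (c + d) := by
  intro x y h1 h2 h3
  obtain ⟨ga, gb⟩ := hg x y h1 h2 h3
  obtain ⟨fa, fb⟩ := hf (g x) (g y) (g.monotone h1) (g.monotone h2) (g.monotone h3)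
  simp only [RelIso.mul_apply]
  have pA : (0 : ℝ) < g w' - g w := coe_sub_pos (g.strictMono hw)
  have pA' := map_sub_nonneg f (g.monotone hw.le)
  have pB' := map_sub_nonneg f (g.monotone h2)
  have pL := coe_sub_nonneg hw.le
  have pl := coe_sub_nonneg h2
  generalize (g w' : ℝ) - g w = A at *
  generalize (g y : ℝ) - g x = B at *
  generalize (f (g w') : ℝ) - f (g w) = A' at *
  generalize (f (g y) : ℝ) - f (g x) = B' at *
  generalize (w' : ℝ) - w = L at *
  generalize (y : ℝ) - x = l at *
  rw [Real.exp_add]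
  have ec := Real.exp_pos c
  have ed := Real.exp_pos d
  constructor
  · refine le_of_mul_le_mul_right ?_ pA
    calc A' * l * A = A' * (A * l) := by ring
      _ ≤ A' * (Real.exp c * (B * L)) := by gcongr
      _ = Real.exp c * (A' * B) * L := by ring
      _ ≤ Real.exp c * (Real.exp d * (B' * A)) * L := by gcongr
      _ = _ := by ring
  · refine le_of_mul_le_mul_right ?_ pA
    calc B' * L * A = (B' * A) * L := by ring
      _ ≤ (Real.exp d * (A' * B)) * L := by gcongr
      _ = Real.exp d * A' * (B * L) := by ring
      _ ≤ Real.exp d * A' * (Real.exp c * (A * l)) := by gcongr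
      _ = _ := by ring

theorem HolderDistortion.mono {β C C' : ℝ} {f : I ≃o I} (h : HolderDistortion β C f)
    (hC : C ≤ C') : HolderDistortion β C' f := fun w w' hw => (h w w' hw).mono <| by
  have := Real.rpow_nonneg (coe_sub_nonneg hw) β
  gcongr

theorem exists_derivWithin_eq_slope {f : I ≃o I} (hf : ContDiffOn ℝ 1 (realExt f) (Icc 0 1))
    {x y : I} (h : x < y) : ∃ ξ : I, x ≤ ξ ∧ ξ ≤ y ∧
      derivWithin (realExt f) (Icc 0 1) ξ * ((y : ℝ) - x) = f y - f x := by
  have hxy : (x : ℝ) < y := h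
  have hsub : Icc (x : ℝ) y ⊆ Icc 0 1 := Icc_subset_Icc x.2.1 y.2.2
  have hsub' : Ioo (x : ℝ) y ⊆ Ioo 0 1 := Ioo_subset_Ioo x.2.1 y.2.2
  obtain ⟨ξ, hξ, he⟩ := exists_deriv_eq_slope (realExt f) hxy (hf.continuousOn.mono hsub)
    ((hf.differentiableOn one_ne_zero).mono (Ioo_subset_Icc_self.trans hsub))
  refine ⟨⟨ξ, hsub (Ioo_subset_Icc_self hξ)⟩, hξ.1.le, hξ.2.le, ?_⟩
  have h1 : derivWithin (realExt f) (Icc 0 1) ξ = deriv (realExt f) ξ :=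
    derivWithin_of_mem_nhds (Icc_mem_nhds (hsub' hξ).1 (hsub' hξ).2)
  change derivWithin (realExt f) (Icc 0 1) ξ * _ = _
  rw [h1, he, realExt_coe, realExt_coe, div_mul_cancel₀]
  exact (sub_pos.2 hxy).ne'

theorem IsDiffHolder.exists_le_derivWithin {α : ℝ≥0} {f : I ≃o I} (hf : IsDiffHolder α f) :
    ∃ L : ℝ, 0 ≤ L ∧ ∀ x : I, 1 ≤ L * |derivWithin (realExt f) (Icc 0 1) x| := by
  obtain ⟨L, hL0, hL, -⟩ := derivWithin_realExt_bound hf.2.1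
  refine ⟨L, hL0, fun x => ?_⟩
  have h1 := derivWithin_realExt_mul hf.2.1 hf.1 x.2
  have h2 : f.symm * f = 1 := inv_mul_cancel f
  rw [h2, derivWithin_realExt_one x.2] at h1
  have h3 := hL _ (realExt_mem f x)
  calc (1 : ℝ) = |derivWithin (realExt f.symm) (Icc 0 1) (realExt f x)| *
        |derivWithin (realExt f) (Icc 0 1) x| := by rw [← abs_mul, ← h1, abs_one]
    _ ≤ _ := by gcongr

/-- Slopes are values of the derivative, which is Hölder and bounded away from 0; hence ratios of
slopes are close to 1. The exponent may be lowered to `β` because all lengths are at most 1. -/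
theorem IsDiffHolder.exists_holderDistortion {α : ℝ≥0} {β : ℝ} (hβ : 0 < β) (hβα : β ≤ α) {f : I ≃o I}
    (hf : IsDiffHolder α f) : ∃ C : ℝ, HolderDistortion β C f := by
  obtain ⟨A, hA⟩ := (holderOnWith_iff_abs _ _ _).1 hf.2.2
  obtain ⟨L, hL0, hL⟩ := hf.exists_le_derivWithin
  have key : ∀ w x y x' y' w' : I, w ≤ x → x < y → y ≤ w' → w ≤ x' → x' < y' → y' ≤ w' →
      ((f y : ℝ) - f x) * (y' - x') ≤
        Real.exp (L * |A| * ((w' : ℝ) - w) ^ β) * (((f y' : ℝ) - f x') * (y - x)) := by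
    intro w x y x' y' w' h1 h2 h3 h1' h2' h3'
    obtain ⟨ξ, hξ1, hξ2, hξ⟩ := exists_derivWithin_eq_slope hf.1 h2
    obtain ⟨η, hη1, hη2, hη⟩ := exists_derivWithin_eq_slope hf.1 h2'
    have hh := hA ξ ξ.2 η η.2
    have hl := hL η
    have hw : w ≤ w' := h1.trans (h2.le.trans h3)
    have hd : |(ξ : ℝ) - η| ≤ w' - w := by
      have a1 : (w : ℝ) ≤ ξ := h1.trans hξ1
      have a2 : (ξ : ℝ) ≤ w' := hξ2.trans h3
      have a3 : (w : ℝ) ≤ η := h1'.trans hη1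
      have a4 : (η : ℝ) ≤ w' := hη2.trans h3'
      rw [abs_le]; constructor <;> linarith
    have hr : |(ξ : ℝ) - η| ^ (α : ℝ) ≤ ((w' : ℝ) - w) ^ β := by
      rcases eq_or_lt_of_le (abs_nonneg ((ξ : ℝ) - η)) with h0 | h0
      · rw [← h0, Real.zero_rpow (hβ.trans_le hβα).ne']
        exact Real.rpow_nonneg (coe_sub_nonneg hw) _
      · exact (Real.rpow_le_rpow_of_exponent_ge h0 (hd.trans (coe_sub_le_one _ _)) hβα).trans
          (Real.rpow_le_rpow h0.le hd hβ.le)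
    have q1 : (0 : ℝ) < y - x := coe_sub_pos h2
    have q2 : (0 : ℝ) < y' - x' := coe_sub_pos h2'
    have q3 : (0 : ℝ) < f y' - f x' := coe_sub_pos (f.strictMono h2')
    rw [← hξ, ← hη]
    rw [← hη] at q3
    generalize derivWithin (realExt f) (Icc 0 1) ξ = a at *
    generalize derivWithin (realExt f) (Icc 0 1) η = b at *
    have hb : 0 < b := pos_of_mul_pos_left q3 q2.le
    rw [abs_of_pos hb] at hl
    have hab : a - b ≤ |A| * ((w' : ℝ) - w) ^ β := by
      refine (le_abs_self _).trans (hh.trans ?_)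
      gcongr
      exact le_abs_self A
    have hc : 0 ≤ |A| * ((w' : ℝ) - w) ^ β :=
      mul_nonneg (abs_nonneg _) (Real.rpow_nonneg (coe_sub_nonneg hw) _)
    have he := Real.add_one_le_exp (L * |A| * ((w' : ℝ) - w) ^ β)
    have hfin : a ≤ Real.exp (L * |A| * ((w' : ℝ) - w) ^ β) * b := by
      calc a ≤ b + 1 * (|A| * ((w' : ℝ) - w) ^ β) := by linarith
        _ ≤ b + (L * b) * (|A| * ((w' : ℝ) - w) ^ β) := by gcongr
        _ = (L * |A| * ((w' : ℝ) - w) ^ β + 1) * b := by ring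
        _ ≤ _ := by gcongr
    calc a * (y - x) * (y' - x')
        ≤ (Real.exp (L * |A| * ((w' : ℝ) - w) ^ β) * b) * (y - x) * (y' - x') := by gcongr
      _ = _ := by ring
  -- Both inequalities are instances of `key`, with the two subintervals exchanged.
  refine ⟨L * |A|, fun w w' _ x y h1 h2 h3 => ?_⟩
  rcases h2.eq_or_lt with rfl | h2
  · simp
  · have hw : w < w' := h1.trans_lt (h2.trans_le h3)
    exact ⟨key w w w' x y w' le_rfl hw le_rfl h1 h2 h3, key w x y w w' w' h1 h2 h3 le_rfl hw le_rfl⟩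

theorem IsDiffHolder.exists_lipschitz {α : ℝ≥0} {f : I ≃o I} (hf : IsDiffHolder α f) :
    ∃ K : ℝ, 1 ≤ K ∧ ∀ x y : I, x ≤ y → (f y : ℝ) - f x ≤ K * (y - x) := by
  obtain ⟨K, hK0, -, hK⟩ := derivWithin_realExt_bound hf.1
  refine ⟨max 1 K, le_max_left _ _, fun x y h => ?_⟩
  have h1 := hK y y.2 x x.2
  rw [realExt_coe, realExt_coe, abs_of_nonneg (coe_sub_nonneg h)] at h1
  have h0 := coe_sub_nonneg h
  exact (le_abs_self _).trans (h1.trans (by gcongr; exact le_max_right _ _))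

/-! ### Disjoint intervals and cheap paths in the grid. -/

theorem sum_length_le_one {ι : Type*} (T : Finset ι) (l r : ι → I)
    (hlr : ∀ i, l i ≤ r i) (hd : ∀ i ∈ T, ∀ j ∈ T, i ≠ j → r i ≤ l j ∨ r j ≤ l i) :
    ∑ i ∈ T, ((r i : ℝ) - l i) ≤ 1 := by
  have h1 : MeasureTheory.volume (⋃ i ∈ T, Ioo (l i : ℝ) (r i)) =
      ∑ i ∈ T, MeasureTheory.volume (Ioo (l i : ℝ) (r i)) := by
    refine MeasureTheory.measure_biUnion_finset (fun i hi j hj hij => ?_)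
      (fun i _ => measurableSet_Ioo)
    refine Set.disjoint_left.2 fun x hx hx' => ?_
    rcases hd i hi j hj hij with h | h
    · exact absurd (hx.2.trans_le h) hx'.1.not_gt
    · exact absurd (hx'.2.trans_le h) hx.1.not_gt
  have h2 : MeasureTheory.volume (⋃ i ∈ T, Ioo (l i : ℝ) (r i)) ≤ ENNReal.ofReal 1 := by
    refine (MeasureTheory.measure_mono (t := Icc (0 : ℝ) 1) ?_).trans (by simp)
    refine iUnion₂_subset fun i _ => Ioo_subset_Icc_self.trans ?_
    exact Icc_subset_Icc (l i).2.1 (r i).2.2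
  rw [h1] at h2
  simp only [Real.volume_Ioo] at h2
  rw [← ENNReal.ofReal_sum_of_nonneg (fun i _ => coe_sub_nonneg (hlr i))] at h2
  exact (ENNReal.ofReal_le_ofReal_iff zero_le_one).1 h2

/-- The expected cost of a random path to the point `i` of the `k`-th diagonal of `ℕ × ℕ`, for
the Pólya urn, which is uniformly distributed on each diagonal. -/
noncomputable def pathCost (ℓ : ℕ → ℕ → ℝ) : ℕ → ℕ → ℝ
  | 0, _ => 0
  | k + 1, i => (i * (pathCost ℓ k (i - 1) + ℓ k (i - 1)) +
      (k + 1 - i) * (pathCost ℓ k i + ℓ k i)) / (k + 1)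

theorem pathCost_nonneg {ℓ : ℕ → ℕ → ℝ} (hℓ : ∀ k i, 0 ≤ ℓ k i) (k : ℕ) :
    ∀ i ≤ k, 0 ≤ pathCost ℓ k i := by
  induction k with
  | zero => intro i _; simp [pathCost]
  | succ k ih =>
    intro i hi
    have hi' : (0 : ℝ) ≤ k + 1 - i := by
      have : (i : ℝ) ≤ (k + 1 : ℕ) := by exact_mod_cast hi
      push_cast at this; linarith
    rw [pathCost]
    refine div_nonneg (add_nonneg ?_ ?_) (by positivity)
    · exact mul_nonneg (by positivity) (add_nonneg (ih _ (by omega)) (hℓ _ _))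
    · rcases Nat.lt_or_ge k i with h | h
      · obtain rfl : i = k + 1 := by omega
        simp
      · exact mul_nonneg hi' (add_nonneg (ih _ h) (hℓ _ _))

/-- The urn is uniform on every diagonal, so its expected total cost is the sum of the diagonal
means; the left side is `n + 1` times this expectation. -/
theorem sum_pathCost (ℓ : ℕ → ℕ → ℝ) (n : ℕ) :
    ∑ i ∈ Finset.range (n + 1), pathCost ℓ n i =
      (n + 1) * ∑ k ∈ Finset.range n, (∑ i ∈ Finset.range (k + 1), ℓ k i) / (k + 1) := by
  induction n with
  | zero => simp [pathCost]
  | succ n ih =>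
    have hn : (n : ℝ) + 1 ≠ 0 := by positivity
    have h1 : ∑ i ∈ Finset.range (n + 2), pathCost ℓ (n + 1) i =
        (n + 2) / (n + 1) * ∑ i ∈ Finset.range (n + 1), (pathCost ℓ n i + ℓ n i) := by
      simp only [pathCost]
      rw [← Finset.sum_div, Finset.sum_add_distrib, Finset.sum_range_succ',
        Finset.sum_range_succ (fun i : ℕ => ((n : ℝ) + 1 - i) * (pathCost ℓ n i + ℓ n i)),
        div_mul_eq_mul_div]
      congr 1
      simp only [Nat.add_sub_cancel, Nat.cast_add, Nat.cast_one, sub_self, zero_mul, add_zero,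
        Nat.cast_zero]
      rw [← Finset.sum_add_distrib, Finset.mul_sum]
      exact Finset.sum_congr rfl fun i _ => by ring
    rw [h1, Finset.sum_add_distrib, ih,
      Finset.sum_range_succ (fun k : ℕ => (∑ i ∈ Finset.range (k + 1), ℓ k i) / ((k : ℝ) + 1)) n]
    generalize ∑ k ∈ Finset.range n, (∑ i ∈ Finset.range (k + 1), ℓ k i) / ((k : ℝ) + 1) = S
    push_cast
    field_simp
    ring

/-- If the mean costs of the diagonals of `ℕ × ℕ` have bounded sums, then there are arbitrarily
long paths of bounded cost which end in the upper half of a diagonal. -/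
theorem exists_cheap_path {ℓ : ℕ → ℕ → ℝ} (hℓ : ∀ k i, 0 ≤ ℓ k i) {M : ℝ}
    (hM : ∀ n, ∑ k ∈ Finset.range n, (∑ i ∈ Finset.range (k + 1), ℓ k i) / (k + 1) ≤ M)
    {P : ℕ → ℕ → ℝ → Prop} (hmono : ∀ k i c c', c ≤ c' → P k i c → P k i c') (h0 : P 0 0 0)
    (hstep : ∀ k i c, i ≤ k → P k i c → P (k + 1) (i + 1) (c + ℓ k i) ∧ P (k + 1) i (c + ℓ k i))
    (m : ℕ) : ∃ i, m ≤ i ∧ i ≤ 2 * m ∧ P (2 * m) i (2 * M) := by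
  have hP : ∀ k, ∀ i ≤ k, P k i (pathCost ℓ k i) := by
    intro k
    induction k with
    | zero => intro i hi; obtain rfl : i = 0 := by omega
              simpa [pathCost] using h0
    | succ k ih =>
      intro i hi
      have hk : (0 : ℝ) < k + 1 := by positivity
      rcases Nat.eq_zero_or_pos i with rfl | hpos
      · refine hmono _ _ _ _ ?_ (hstep k 0 _ (by omega) (ih 0 (by omega))).2
        rw [pathCost]
        simp [hk.ne']
      · obtain ⟨i, rfl⟩ : ∃ j, i = j + 1 := ⟨i - 1, by omega⟩
        have hA := (hstep k i _ (by omega) (ih i (by omega))).1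
        rcases Nat.lt_or_ge k (i + 1) with h | h
        · obtain rfl : i = k := by omega
          refine hmono _ _ _ _ ?_ hA
          rw [pathCost]
          simp [hk.ne']
        · have hB := (hstep k (i + 1) _ h (ih (i + 1) h)).2
          have hki : (0 : ℝ) ≤ k - i := by
            have : (i : ℝ) ≤ k := by exact_mod_cast (by omega : i ≤ k)
            linarith
          -- The cheaper of the two predecessors costs no more than their weighted mean.
          rcases le_total (pathCost ℓ k i + ℓ k i) (pathCost ℓ k (i + 1) + ℓ k (i + 1)) with h' | h'
          · refine hmono _ _ _ _ ?_ hA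
            rw [pathCost, le_div_iff₀ hk, Nat.add_sub_cancel]
            push_cast
            nlinarith [mul_le_mul_of_nonneg_left h' hki]
          · refine hmono _ _ _ _ ?_ hB
            rw [pathCost, le_div_iff₀ hk, Nat.add_sub_cancel]
            push_cast
            nlinarith [mul_le_mul_of_nonneg_left h' (by positivity : (0 : ℝ) ≤ i + 1)]
  have hM0 : 0 ≤ M := by simpa using hM 0
  by_contra! hcon
  -- These `m + 1` points alone would cost more than `2 * M * (m + 1)`, but the whole diagonal costs
  -- at most `(2 * m + 1) * M`.
  have hbig : ∀ i ∈ Finset.Icc m (2 * m), 2 * M < pathCost ℓ (2 * m) i := by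
    intro i hi
    rw [Finset.mem_Icc] at hi
    by_contra! h
    exact hcon i hi.1 hi.2 (hmono _ _ _ _ h (hP _ i hi.2))
  have h1 : ∑ i ∈ Finset.Icc m (2 * m), 2 * M < ∑ i ∈ Finset.Icc m (2 * m), pathCost ℓ (2 * m) i :=
    Finset.sum_lt_sum_of_nonempty (Finset.nonempty_Icc.2 (by omega)) hbig
  have h2 : ∑ i ∈ Finset.Icc m (2 * m), pathCost ℓ (2 * m) i ≤
      ∑ i ∈ Finset.range (2 * m + 1), pathCost ℓ (2 * m) i := by
    refine Finset.sum_le_sum_of_subset_of_nonneg (fun i hi => ?_) fun i hi _ => ?_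
    · rw [Finset.mem_Icc] at hi; rw [Finset.mem_range]; omega
    · rw [Finset.mem_range] at hi
      exact pathCost_nonneg hℓ _ _ (by omega)
  rw [sum_pathCost] at h2
  have h3 := mul_le_mul_of_nonneg_left (hM (2 * m)) (by positivity : (0 : ℝ) ≤ (2 * m : ℕ) + 1)
  rw [Finset.sum_const, Nat.card_Icc, nsmul_eq_mul,
    show 2 * m + 1 - m = m + 1 by omega] at h1
  push_cast at h1 h2 h3
  nlinarith

/-- Weighted AM-GM splits each term into a length, whose total is at most 1, and a power of `k + 1`.
The `k + 1` powers on a diagonal add up to `(k + 1) ^ q`, and `q < -1` says exactly that `β` exceeds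
1/2. -/
theorem exists_sum_mean_rpow_le {β : ℝ} (hβ : 1 / 2 < β) (hβ1 : β < 1) :
    ∃ M : ℝ, ∀ L : ℕ → ℕ → ℝ, (∀ k i, 0 ≤ L k i) →
      (∀ n, ∑ k ∈ Finset.range n, ∑ i ∈ Finset.range (k + 1), L k i ≤ 1) →
      ∀ n, ∑ k ∈ Finset.range n, (∑ i ∈ Finset.range (k + 1), L k i ^ β) / (k + 1) ≤ M := by
  have hb : 0 < 1 - β := by linarith
  set q : ℝ := 1 - 1 / (1 - β) with hq
  have hq1 : q < -1 := by
    have : 2 < 1 / (1 - β) := by rw [lt_div_iff₀ hb]; linarith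
    linarith
  have hs : Summable fun k : ℕ => ((k : ℝ) + 1) ^ q := by
    have := (summable_nat_add_iff 1).2 (Real.summable_nat_rpow.2 hq1)
    simpa using this
  refine ⟨1 + ∑' k : ℕ, ((k : ℝ) + 1) ^ q, fun L hL hsum n => ?_⟩
  have hterm : ∀ k i, L k i ^ β / (k + 1) ≤ L k i + ((k : ℝ) + 1) ^ (-(1 / (1 - β))) := by
    intro k i
    have hk : (0 : ℝ) < k + 1 := by positivity
    have hp : 0 ≤ ((k : ℝ) + 1) ^ (-(1 / (1 - β))) := by positivity
    have h := Real.geom_mean_le_arith_mean2_weighted (by linarith : 0 ≤ β) hb.le (hL k i) hp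
      (by ring)
    rw [← Real.rpow_mul hk.le, neg_mul, one_div_mul_cancel hb.ne', Real.rpow_neg_one] at h
    rw [div_eq_mul_inv]
    nlinarith [hL k i]
  have hdiag : ∀ k, (∑ i ∈ Finset.range (k + 1), L k i ^ β) / (k + 1) ≤
      ∑ i ∈ Finset.range (k + 1), L k i + ((k : ℝ) + 1) ^ q := by
    intro k
    have hk : (0 : ℝ) < k + 1 := by positivity
    rw [Finset.sum_div]
    refine (Finset.sum_le_sum fun i _ => hterm k i).trans_eq ?_
    rw [Finset.sum_add_distrib, Finset.sum_const, Finset.card_range, nsmul_eq_mul, hq,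
      sub_eq_add_neg 1 (1 / (1 - β)), Real.rpow_add hk, Real.rpow_one]
    push_cast
    rfl
  refine (Finset.sum_le_sum fun k _ => hdiag k).trans ?_
  rw [Finset.sum_add_distrib]
  exact add_le_add (hsum n) (hs.sum_le_tsum _ fun k _ => by positivity)

/-! ### Orbits, fixed points and components of their complement. -/

theorem pow_mul_eq_mul_pow_mul_zpow {G : Type*} [Group G] {s t z : G} {k : ℤ}
    (hst : s * t = t * s * z ^ k) (hzs : Commute z s) (n : ℕ) :
    s ^ n * t = t * s ^ n * z ^ (k * n) := by
  induction n with
  | zero => simp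
  | succ n ih =>
    have h := (hzs.zpow_left (k * n)).eq
    calc s ^ (n + 1) * t = s ^ n * (s * t) := by rw [pow_succ, mul_assoc]
      _ = (s ^ n * t) * s * z ^ k := by rw [hst]; simp only [mul_assoc]
      _ = t * s ^ n * (z ^ (k * n) * s) * z ^ k := by rw [ih]; simp only [mul_assoc]
      _ = t * (s ^ n * s) * (z ^ (k * n) * z ^ k) := by rw [h]; simp only [mul_assoc]
      _ = _ := by rw [← pow_succ, ← zpow_add]; congr 2; push_cast; ring

theorem apply_zpow_eq_of_fixed {f : I ≃o I} {x : I} (h : f x = x) (n : ℤ) : (f ^ n) x = x := by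
  have hp : ∀ m : ℕ, (f ^ m) x = x := by
    intro m
    induction m with
    | zero => rfl
    | succ m ih => rw [pow_succ, RelIso.mul_apply, h, ih]
  obtain ⟨m, rfl | rfl⟩ := n.eq_nat_or_neg
  · rw [zpow_natCast, hp]
  · rw [zpow_neg, zpow_natCast, ← RelIso.apply_eq_iff_eq (f ^ m), ← RelIso.mul_apply,
      mul_inv_cancel, hp]
    rfl

theorem fixed_apply_of_commute {z g : I ≃o I} (h : Commute z g) {x : I} (hx : z x = x) :
    z (g x) = g x := by
  rw [← RelIso.mul_apply, h.eq, RelIso.mul_apply, hx]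

theorem zpow_fixed_imp_fixed {f : I ≃o I} {x : I} {n : ℤ} (hn : n ≠ 0) (h : (f ^ n) x = x) :
    f x = x := by
  have hp : ∀ m : ℕ, m ≠ 0 → (f ^ m) x = x → f x = x := by
    intro m hm hx
    by_contra hne
    rcases lt_or_gt_of_ne hne with hlt | hlt
    · have : ∀ j : ℕ, (f ^ (j + 1)) x < x := by
        intro j
        induction j with
        | zero => simpa using hlt
        | succ j ih =>
          rw [pow_succ, RelIso.mul_apply]
          exact ((f ^ (j + 1)).strictMono hlt).trans ih
      obtain ⟨j, rfl⟩ := Nat.exists_eq_succ_of_ne_zero hm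
      exact (this j).ne hx
    · have : ∀ j : ℕ, x < (f ^ (j + 1)) x := by
        intro j
        induction j with
        | zero => simpa using hlt
        | succ j ih =>
          rw [pow_succ, RelIso.mul_apply]
          exact ih.trans ((f ^ (j + 1)).strictMono hlt)
      obtain ⟨j, rfl⟩ := Nat.exists_eq_succ_of_ne_zero hm
      exact (this j).ne' hx
  obtain ⟨m, rfl | rfl⟩ := n.eq_nat_or_neg
  · exact hp m (by simpa using hn) (by simpa using h)
  · refine hp m (by simpa using hn) ?_
    have := apply_zpow_eq_of_fixed h (-1)
    simpa using this

/-- The orbit is monotone and bounded, hence convergent. -/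
theorem tendsto_iterate_sub (f : I ≃o I) (p : I) :
    Filter.Tendsto (fun n : ℕ => (((f ^ (n + 1)) p : I) : ℝ) - (f ^ n) p) Filter.atTop
      (nhds 0) := by
  have key : ∃ l : ℝ, Filter.Tendsto (fun n : ℕ => (((f ^ n) p : I) : ℝ)) Filter.atTop (nhds l) := by
    rcases le_total p (f p) with h | h
    · have hm : Monotone fun n : ℕ => (((f ^ n) p : I) : ℝ) := monotone_nat_of_le_succ fun n => by
        rw [pow_succ, RelIso.mul_apply]; exact (f ^ n).monotone h
      exact ⟨_, tendsto_atTop_ciSup hm ⟨1, by rintro _ ⟨n, rfl⟩; exact ((f ^ n) p).2.2⟩⟩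
    · have hm : Antitone fun n : ℕ => (((f ^ n) p : I) : ℝ) := antitone_nat_of_succ_le fun n => by
        rw [pow_succ, RelIso.mul_apply]; exact (f ^ n).monotone h
      exact ⟨_, tendsto_atTop_ciInf hm ⟨0, by rintro _ ⟨n, rfl⟩; exact ((f ^ n) p).2.1⟩⟩
  obtain ⟨l, hl⟩ := key
  simpa using ((Filter.tendsto_add_atTop_iff_nat 1).2 hl).sub hl

theorem exists_forall_zpow_sub_lt (f : I ≃o I) (p : I) {ε : ℝ} (hε : 0 < ε) :
    ∃ N : ℕ, ∀ n : ℤ, N ≤ n.natAbs → (((f ^ n) (f p) : I) : ℝ) - (f ^ n) p < ε := by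
  have h1 := (tendsto_iterate_sub f p).eventually_lt_const hε
  have h2 := (tendsto_iterate_sub f⁻¹ p).eventually_const_lt (neg_lt_zero.2 hε)
  obtain ⟨N, hN⟩ := Filter.eventually_atTop.1 (h1.and h2)
  refine ⟨N + 1, fun n hn => ?_⟩
  obtain ⟨m, rfl | rfl⟩ := n.eq_nat_or_neg
  · have := (hN m (by simp at hn; omega)).1
    rwa [zpow_natCast, ← RelIso.mul_apply, ← pow_succ]
  · obtain ⟨j, rfl⟩ : ∃ j, m = j + 1 := ⟨m - 1, by simp at hn; omega⟩
    have h := (hN j (by simp at hn; omega)).2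
    have e1 : (f ^ (-((j + 1 : ℕ) : ℤ))) (f p) = (f⁻¹ ^ j) p := by
      rw [← RelIso.mul_apply, zpow_neg, zpow_natCast, ← inv_pow, pow_succ, mul_assoc,
        inv_mul_cancel, mul_one]
    have e2 : (f ^ (-((j + 1 : ℕ) : ℤ))) p = (f⁻¹ ^ (j + 1)) p := by
      rw [zpow_neg, zpow_natCast, inv_pow]
    rw [e1, e2]
    linarith

/-- `(v, w)` is a component of the complement of the fixed points of `z`. -/
structure IsFreeInterval (z : I ≃o I) (v w : I) : Prop where
  lt : v < w
  left : z v = v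
  right : z w = w
  free : ∀ x, v < x → x < w → z x ≠ x

/-- Maps commuting with `z` preserve its fixed points. If two images overlapped, pulling an end
point of one back would give a fixed point inside `(v, w)`. -/
theorem IsFreeInterval.disjoint_images {z : I ≃o I} {v w : I} (hv : IsFreeInterval z v w)
    {g g' : I ≃o I} (hg : Commute z g) (hg' : Commute z g') (hne : g v ≠ g' v) :
    g w ≤ g' v ∨ g' w ≤ g v := by
  have key : ∀ {g g' : I ≃o I}, Commute z g → Commute z g' → g v < g' v → g w ≤ g' v := by
    intro g g' hg hg' hlt
    by_contra! h
    refine hv.free (g⁻¹ (g' v)) ?_ ?_ ?_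
    · rw [← g.lt_iff_lt, RelIso.apply_inv_self]; exact hlt
    · rw [← g.lt_iff_lt, RelIso.apply_inv_self]; exact h
    · exact fixed_apply_of_commute hg.inv_right (fixed_apply_of_commute hg' hv.left)
  rcases lt_or_gt_of_ne hne with h | h
  · exact Or.inl (key hg hg' h)
  · exact Or.inr (key hg' hg h)

theorem IsFreeInterval.apply_right {z : I ≃o I} {v w : I} (hv : IsFreeInterval z v w)
    {g : I ≃o I} (hg : Commute z g) (h : g v = v) : g w = w := by
  have key : ∀ {g : I ≃o I}, Commute z g → g v = v → w ≤ g w := by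
    intro g hg h
    by_contra! hlt
    refine hv.free (g w) ?_ hlt (fixed_apply_of_commute hg hv.right)
    have := g.strictMono hv.lt
    rwa [h] at this
  refine le_antisymm ?_ (key hg h)
  have h' := key hg.inv_right (by simpa using apply_zpow_eq_of_fixed h (-1))
  have := g.monotone h'
  rwa [RelIso.apply_inv_self] at this

/-- The end points are the infimum and supremum of the two-sided orbit of `p`. A fixed point
strictly between them would separate the orbit, which is impossible. -/
theorem exists_isFreeInterval {z : I ≃o I} {p : I} (hp : z p ≠ p) :
    ∃ v w, IsFreeInterval z v w ∧ v < p ∧ p < w := by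
  have hfix : ∀ e : ℤ → I, (∀ n, e n = (z ^ n) p) → z (⨅ n, e n) = ⨅ n, e n ∧
      z (⨆ n, e n) = ⨆ n, e n := by
    intro e he
    have h : ∀ n, z (e n) = e (n + 1) := fun n => by
      rw [he, he, add_comm, zpow_one_add, RelIso.mul_apply]
    rw [OrderIso.map_iInf, OrderIso.map_iSup]
    simp only [h]
    exact ⟨(Equiv.addRight (1 : ℤ)).iInf_comp (g := e), (Equiv.addRight (1 : ℤ)).iSup_comp (g := e)⟩
  obtain ⟨hl, hr⟩ := hfix (fun n => (z ^ n) p) fun _ => rfl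
  have hle : ∀ n : ℤ, ⨅ n : ℤ, (z ^ n) p ≤ (z ^ n) p := iInf_le _
  have hge : ∀ n : ℤ, (z ^ n) p ≤ ⨆ n : ℤ, (z ^ n) p := le_iSup fun n : ℤ => (z ^ n) p
  have h1 : (⨅ n : ℤ, (z ^ n) p) < p := by
    refine lt_of_le_of_ne (by simpa using hle 0) fun h => hp ?_
    rwa [h] at hl
  have h2 : p < ⨆ n : ℤ, (z ^ n) p := by
    refine lt_of_le_of_ne (by simpa using hge 0) fun h => hp ?_
    rwa [← h] at hr
  refine ⟨_, _, ⟨h1.trans h2, hl, hr, fun x hx hx' hzx => ?_⟩, h1, h2⟩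
  obtain ⟨m, hm⟩ := iInf_lt_iff.1 hx
  obtain ⟨n, hn⟩ := lt_iSup_iff.1 hx'
  rw [← apply_zpow_eq_of_fixed hzx m, OrderIso.lt_iff_lt] at hm
  rw [← apply_zpow_eq_of_fixed hzx n, OrderIso.lt_iff_lt] at hn
  exact hm.not_gt hn

/-! ### Bounded distortion along a grid of disjoint intervals. -/

/-- A grid of intervals `s ^ i * t ^ j` has a point far away where the distortion is bounded. -/
theorem exists_bounded_distortion {z s t u : I ≃o I} {v w : I} (hv : IsFreeInterval z v w)
    (hzs : Commute z s) (hzt : Commute z t) (hzu : Commute z u) {k c : ℤ}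
    (hst : s * t = t * s * z ^ k) (hsu : s * u = u * s * z ^ c) (htu : Commute t u)
    {β C K : ℝ} (hβ : 1 / 2 < β) (hβ1 : β < 1) (hs : HolderDistortion β C s)
    (ht : HolderDistortion β C t) (hC : 0 ≤ C) (hK : 1 ≤ K)
    (hu : ∀ x y : I, x ≤ y → (u y : ℝ) - u x ≤ K * (y - x))
    (hfree : ∀ i j i' j' : ℕ, (s ^ i * t ^ j) v = (s ^ i' * t ^ j') v → i = i' ∧ j = j') :
    ∃ D : ℝ, ∀ m : ℕ, ∃ i : ℕ, m ≤ i ∧ ∃ g : I ≃o I, Commute z g ∧ g * u = u * g * z ^ (c * i) ∧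
      DistortionBound g v w D ∧ DistortionBound g (u v) (u w) D := by
  have hzg : ∀ i j : ℕ, Commute z (s ^ i * t ^ j) := fun i j =>
    (hzs.pow_right i).mul_right (hzt.pow_right j)
  set len : ℕ → ℕ → ℝ := fun k i => ((s ^ i * t ^ (k - i)) w : ℝ) - (s ^ i * t ^ (k - i)) v with hlen
  have hlen0 : ∀ k i, 0 ≤ len k i := fun k i => map_sub_nonneg _ hv.lt.le
  have hsum : ∀ n, ∑ k ∈ Finset.range n, ∑ i ∈ Finset.range (k + 1), len k i ≤ 1 := by
    intro n
    rw [Finset.sum_sigma']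
    refine sum_length_le_one _ (fun a : (_ : ℕ) × ℕ => (s ^ a.2 * t ^ (a.1 - a.2)) v)
      (fun a => (s ^ a.2 * t ^ (a.1 - a.2)) w) (fun a => OrderIso.monotone _ hv.lt.le) ?_
    rintro ⟨k, i⟩ hki ⟨k', i'⟩ hki' hne
    simp only [Finset.mem_sigma, Finset.mem_range] at hki hki'
    refine hv.disjoint_images (hzg _ _) (hzg _ _) fun h => hne ?_
    obtain ⟨h1, h2⟩ := hfree _ _ _ _ h
    dsimp only at h1 h2
    obtain rfl := h1
    obtain rfl : k = k' := by omega
    rfl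
  obtain ⟨M, hM⟩ := exists_sum_mean_rpow_le hβ hβ1
  have hM' := hM len hlen0 hsum
  have hCK : 0 ≤ C * K ^ β := mul_nonneg hC (Real.rpow_nonneg (by linarith) _)
  -- Powers of `z` are ignored: they fix `v` and `w`, so the image interval depends only on the grid
  -- point.
  set P : ℕ → ℕ → ℝ → Prop := fun k i e => ∃ g : I ≃o I,
    (∃ m : ℤ, g = s ^ i * t ^ (k - i) * z ^ m) ∧ DistortionBound g v w e ∧
      DistortionBound g (u v) (u w) e with hP
  have hcomm : ∀ {g : I ≃o I} {i j : ℕ} {m : ℤ}, g = s ^ i * t ^ j * z ^ m →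
      Commute z g ∧ g * u = u * g * z ^ (c * i) := by
    rintro g i j m rfl
    refine ⟨(hzg i j).mul_right ((Commute.refl z).zpow_right m), ?_⟩
    have e1 := pow_mul_eq_mul_pow_mul_zpow hsu hzs i
    have e2 := (htu.pow_left j).eq
    have e3 := (hzu.zpow_left m).eq
    have e4 : z ^ (c * i) * (t ^ j * z ^ m) = t ^ j * z ^ m * z ^ (c * i) :=
      ((hzt.pow_right j).mul_right ((Commute.refl z).zpow_right m)).zpow_left (c * i)
    calc s ^ i * t ^ j * z ^ m * u = s ^ i * t ^ j * (z ^ m * u) := by simp only [mul_assoc]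
      _ = s ^ i * (t ^ j * u) * z ^ m := by rw [e3]; simp only [mul_assoc]
      _ = (s ^ i * u) * t ^ j * z ^ m := by rw [e2]; simp only [mul_assoc]
      _ = u * s ^ i * (z ^ (c * i) * (t ^ j * z ^ m)) := by rw [e1]; simp only [mul_assoc]
      _ = _ := by rw [e4]; simp only [mul_assoc]
  have hext : ∀ {f g : I ≃o I} {k i : ℕ} {m : ℤ} {e : ℝ}, HolderDistortion β C f →
      g = s ^ i * t ^ (k - i) * z ^ m → DistortionBound g v w e → DistortionBound g (u v) (u w) e →
      DistortionBound (f * g) v w (e + C * K ^ β * len k i ^ β) ∧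
        DistortionBound (f * g) (u v) (u w) (e + C * K ^ β * len k i ^ β) := by
    intro f g k i m e hf hg h1 h2
    obtain ⟨hc1, hc2⟩ := hcomm hg
    have ev : ∀ x, z x = x → g x = (s ^ i * t ^ (k - i)) x := fun x hx => by
      rw [hg, RelIso.mul_apply _ (z ^ m), apply_zpow_eq_of_fixed hx]
    -- On fixed points of `z` the maps `g` and `u` commute, so the path starting at the `u`-image of
    -- the interval has lengths at most `K` times as large.
    have ew : ∀ x, z x = x → g (u x) = u (g x) := fun x hx => by
      rw [← RelIso.mul_apply, hc2, RelIso.mul_apply, apply_zpow_eq_of_fixed hx, RelIso.mul_apply]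
    have el : (g w : ℝ) - g v = len k i := by rw [ev _ hv.left, ev _ hv.right]
    have eu : (g (u w) : ℝ) - g (u v) ≤ K * len k i := by
      rw [ew _ hv.left, ew _ hv.right, ← el]
      exact hu _ _ (g.monotone hv.lt.le)
    have hle : ∀ d : ℝ, 0 ≤ d → d ≤ K * len k i → C * d ^ β ≤ C * K ^ β * len k i ^ β := by
      intro d hd0 hd
      rw [mul_assoc, ← Real.mul_rpow (by linarith) (hlen0 k i)]
      gcongr
    refine ⟨((hf _ _ (g.monotone hv.lt.le)).mono (hle _ ?_ ?_)).comp hv.lt h1,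
      ((hf _ _ (g.monotone (u.monotone hv.lt.le))).mono (hle _ ?_ eu)).comp
        (u.strictMono hv.lt) h2⟩
    · exact map_sub_nonneg g hv.lt.le
    · rw [el]; nlinarith [hlen0 k i]
    · exact map_sub_nonneg g (u.monotone hv.lt.le)
  refine ⟨2 * (C * K ^ β * M), fun m => ?_⟩
  obtain ⟨i, hi1, -, g, ⟨m', hg⟩, h1, h2⟩ := exists_cheap_path (P := P)
    (ℓ := fun k i => C * K ^ β * len k i ^ β) (M := C * K ^ β * M)
    (fun k i => mul_nonneg hCK (Real.rpow_nonneg (hlen0 k i) _))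
    (fun n => by
      simp only [← Finset.mul_sum, mul_div_assoc]
      exact mul_le_mul_of_nonneg_left (hM' n) hCK)
    (fun k i e e' he => by
      rintro ⟨g, hg, h1, h2⟩
      exact ⟨g, hg, h1.mono he, h2.mono he⟩)
    ⟨1, ⟨0, by simp⟩, fun x y _ _ _ => by simp [mul_comm], fun x y _ _ _ => by simp [mul_comm]⟩
    (fun n i e hi => by
      rintro ⟨g, ⟨m, hg⟩, h1, h2⟩
      refine ⟨⟨s * g, ⟨m, ?_⟩, hext hs hg h1 h2⟩, t * g, ⟨-(k * i) + m, ?_⟩, hext ht hg h1 h2⟩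
      · rw [hg, show n + 1 - (i + 1) = n - i by omega, pow_succ']
        simp only [mul_assoc]
      -- Moving the new factor `t` past `s ^ i` costs a power of `z`, absorbed in the free exponent.
      · have e1 := pow_mul_eq_mul_pow_mul_zpow hst hzs i
        have e2 : t * s ^ i = s ^ i * t * z ^ (-(k * i)) := by
          rw [e1, mul_assoc, ← zpow_add, add_neg_cancel, zpow_zero, mul_one]
        have e3 : z ^ (-(k * i)) * t ^ (n - i) = t ^ (n - i) * z ^ (-(k * i)) :=
          ((hzt.pow_right _).zpow_left _).eq
        rw [hg, show n + 1 - i = (n - i) + 1 by omega, pow_succ', zpow_add]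
        calc t * (s ^ i * t ^ (n - i) * z ^ m) = (t * s ^ i) * t ^ (n - i) * z ^ m := by
              simp only [mul_assoc]
          _ = s ^ i * t * (z ^ (-(k * i)) * t ^ (n - i)) * z ^ m := by
              rw [e2]; simp only [mul_assoc]
          _ = _ := by rw [e3]; simp only [mul_assoc])
    m
  obtain ⟨hc1, hc2⟩ := hcomm hg
  exact ⟨i, hi1, g, hc1, hc2, h1, h2⟩

/-- Let `J` be `[p, z p]`. Bounded distortion on `(v, w)` makes `g J` a definite proportion of the
image of `(v, w)`. Yet `u (g J)` is the image under `g * u` of a translate of `J` by a high power of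
`z`, which is tiny, and bounded distortion on `(u v, u w)` keeps it relatively tiny. -/
theorem false_of_grid {z s t u : I ≃o I} {v w p : I} (hv : IsFreeInterval z v w)
    (hvp : v < p) (hpw : p < w) (hp : p < z p)
    (hzs : Commute z s) (hzt : Commute z t) (hzu : Commute z u) {k c : ℤ} (hc : c ≠ 0)
    (hst : s * t = t * s * z ^ k) (hsu : s * u = u * s * z ^ c) (htu : Commute t u)
    {β C K K' : ℝ} (hβ : 1 / 2 < β) (hβ1 : β < 1) (hs : HolderDistortion β C s)
    (ht : HolderDistortion β C t) (hC : 0 ≤ C) (hK : 1 ≤ K) (hK' : 1 ≤ K')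
    (hu : ∀ x y : I, x ≤ y → (u y : ℝ) - u x ≤ K * (y - x))
    (hu' : ∀ x y : I, x ≤ y → (u⁻¹ y : ℝ) - u⁻¹ x ≤ K' * (y - x))
    (hfree : ∀ i j i' j' : ℕ, (s ^ i * t ^ j) v = (s ^ i' * t ^ j') v → i = i' ∧ j = j') :
    False := by
  obtain ⟨D, hD⟩ := exists_bounded_distortion hv hzs hzt hzu hst hsu htu hβ hβ1 hs ht hC hK hu hfree
  have hL : (0 : ℝ) < w - v := coe_sub_pos hv.lt
  have hLu : (0 : ℝ) < u w - u v := coe_sub_pos (u.strictMono hv.lt)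
  have hJ : (0 : ℝ) < z p - p := coe_sub_pos hp
  -- Two distortion factors, one use of the Lipschitz bound for `u⁻¹` and two of that for `u`, as
  -- they arise in the final chain of inequalities.
  set A : ℝ := Real.exp D * Real.exp D * (w - v) * K' * K * K with hA
  have hA0 : 0 < A := by positivity
  obtain ⟨N, hN⟩ := exists_forall_zpow_sub_lt z p
    (ε := ((z p : ℝ) - p) * (u w - u v) / A) (by positivity)
  obtain ⟨i, hi, g, hzg, hgu, h1, h2⟩ := hD N
  have hsmall := hN (-(c * i)) (by
    rw [Int.natAbs_neg, Int.natAbs_mul, Int.natAbs_natCast]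
    exact hi.trans (Nat.le_mul_of_pos_left i (Int.natAbs_pos.2 hc)))
  rw [lt_div_iff₀ hA0] at hsmall
  have hug : ∀ x, g (u ((z ^ (-(c * i))) x)) = u (g x) := by
    intro x
    have hz : Commute (z ^ (c * i)) (z ^ (-(c * i))) := (Commute.refl z).zpow_zpow _ _
    rw [← RelIso.mul_apply g u, hgu, RelIso.mul_apply, ← RelIso.mul_apply (z ^ (c * i)),
      ← zpow_add, add_neg_cancel, zpow_zero, RelIso.one_apply, RelIso.mul_apply]
  have hzv : ∀ n : ℤ, (z ^ n) v = v := apply_zpow_eq_of_fixed hv.left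
  have hzw : ∀ n : ℤ, (z ^ n) w = w := apply_zpow_eq_of_fixed hv.right
  have hzpw : z p < w := by
    have := z.strictMono hpw
    rwa [hv.right] at this
  obtain ⟨B1, -⟩ := h1 p (z p) hvp.le hp.le hzpw.le
  have m1 : ∀ n : ℤ, v ≤ (z ^ n) p := fun n => by
    have := (z ^ n).monotone hvp.le
    rwa [hzv] at this
  have m2 : ∀ n : ℤ, (z ^ n) (z p) ≤ w := fun n => by
    have := (z ^ n).monotone hzpw.le
    rwa [hzw] at this
  have m3 : ∀ n : ℤ, (z ^ n) p ≤ (z ^ n) (z p) := fun n => (z ^ n).monotone hp.le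
  obtain ⟨-, B2⟩ := h2 (u ((z ^ (-(c * i))) p)) (u ((z ^ (-(c * i))) (z p)))
    (u.monotone (m1 _)) (u.monotone (m3 _)) (u.monotone (m2 _))
  have hgv : g (u v) = u (g v) := by rw [← hug v, hzv]
  have hgw : g (u w) = u (g w) := by rw [← hug w, hzw]
  rw [hug, hug, hgv, hgw] at B2
  have B3 := hu _ _ (g.monotone hv.lt.le)
  have B4 := hu _ _ (m3 (-(c * i)))
  have B5 := hu' _ _ (u.monotone (g.monotone hp.le))
  rw [RelIso.inv_apply_self, RelIso.inv_apply_self] at B5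
  have p1 : (0 : ℝ) < g w - g v := coe_sub_pos (g.strictMono hv.lt)
  have p2 : (0 : ℝ) ≤ u (g (z p)) - u (g p) := map_sub_nonneg u (g.monotone hp.le)
  have p3 := map_sub_nonneg u (m3 (-(c * i)))
  have p4 := coe_sub_nonneg (m3 (-(c * i)))
  have p5 := map_sub_nonneg g hp.le
  generalize ((z ^ (-(c * i))) (z p) : ℝ) - ((z ^ (-(c * i))) p) = δ at *
  generalize (g w : ℝ) - g v = G at *
  generalize (u (g w) : ℝ) - u (g v) = G' at *
  generalize (u (g (z p)) : ℝ) - u (g p) = q at *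
  generalize (g (z p) : ℝ) - g p = r at *
  generalize (u ((z ^ (-(c * i))) (z p)) : ℝ) - u ((z ^ (-(c * i))) p) = δ' at *
  generalize (w : ℝ) - v = L at *
  generalize (u w : ℝ) - u v = L' at *
  generalize (z p : ℝ) - p = J at *
  refine hsmall.not_ge (le_of_mul_le_mul_right ?_ p1)
  calc J * L' * G = (G * J) * L' := by ring
    _ ≤ (Real.exp D * (r * L)) * L' := by gcongr
    _ ≤ (Real.exp D * ((K' * q) * L)) * L' := by gcongr
    _ = Real.exp D * K' * L * (q * L') := by ring
    _ ≤ Real.exp D * K' * L * (Real.exp D * (G' * δ')) := by gcongr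
    _ ≤ Real.exp D * K' * L * (Real.exp D * ((K * G) * (K * δ))) := by gcongr
    _ = δ * A * G := by rw [hA]; ring

/-! ### Heisenberg relations inside the stabilizer of a component. -/

theorem zpow_apply_strictMono {z : I ≃o I} {p : I} (hp : p < z p) :
    StrictMono fun n : ℤ => (z ^ n) p := strictMono_int_of_lt_succ fun n => by
  rw [zpow_add_one, RelIso.mul_apply]
  exact (z ^ n).strictMono hp

/-- Otherwise the supremum of the orbit would be a fixed point inside `(v, w)`. -/
theorem IsFreeInterval.exists_le_pow_apply {z : I ≃o I} {v w p q : I} (hv : IsFreeInterval z v w)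
    (hvp : v < p) (hp : p < z p) (hqw : q < w) : ∃ n : ℕ, q ≤ (z ^ n) p := by
  by_contra! h
  have hle : ⨆ n : ℤ, (z ^ n) p ≤ q := iSup_le fun n => by
    have h1 := (zpow_apply_strictMono hp).monotone (Int.self_le_toNat n)
    exact h1.trans (by rw [zpow_natCast]; exact (h n.toNat).le)
  have hge : p ≤ ⨆ n : ℤ, (z ^ n) p := by
    simpa using le_iSup (fun n : ℤ => (z ^ n) p) 0
  refine hv.free _ (hvp.trans_le hge) (hle.trans_lt hqw) ?_
  rw [OrderIso.map_iSup]
  simp only [← RelIso.mul_apply, ← zpow_one_add, add_comm (1 : ℤ)]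
  exact (Equiv.addRight (1 : ℤ)).iSup_comp (g := fun n : ℤ => (z ^ n) p)

theorem pow_apply_le {z f : I ≃o I} (hzf : Commute z f) {p r : I} {A k : ℕ}
    (hA : f p ≤ (z ^ A) p) (hr : r ≤ (z ^ k) p) (n : ℕ) : (f ^ n) r ≤ (z ^ (k + A * n)) p := by
  induction n with
  | zero => simpa using hr
  | succ n ih =>
    rw [pow_succ', RelIso.mul_apply]
    calc f ((f ^ n) r) ≤ f ((z ^ (k + A * n)) p) := f.monotone ih
      _ = (z ^ (k + A * n)) (f p) := by
        rw [← RelIso.mul_apply, ← (hzf.pow_left _).eq, RelIso.mul_apply]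
      _ ≤ (z ^ (k + A * n)) ((z ^ A) p) := OrderIso.monotone _ hA
      _ = (z ^ (k + A * (n + 1))) p := by
        rw [← RelIso.mul_apply, ← pow_add, mul_add, mul_one, add_assoc]

/-- The commutator of `x ^ n` and `y ^ n` is `z ^ (N * n * n)`, but as a word of length `4 * n` it
moves `p` by at most `(A₁ + A₂ + A₃ + A₄) * n` steps of `z`. Taking `n` larger than the sum of these
constants is enough. -/
theorem false_of_commutator_eq_pow {z x y : I ≃o I} {v w p : I} (hv : IsFreeInterval z v w)
    (hvp : v < p) (hpw : p < w) (hp : p < z p) (hzx : Commute z x) (hzy : Commute z y)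
    (hx : x v = v) (hy : y v = v) {N : ℤ} (hN : 0 < N) (hxy : x * y = y * x * z ^ N) : False := by
  have hb : ∀ f : I ≃o I, Commute z f → f v = v → ∃ A : ℕ, f p ≤ (z ^ A) p := fun f hf hfv =>
    hv.exists_le_pow_apply hvp hp <| by
      have := f.strictMono hpw
      rwa [hv.apply_right hf hfv] at this
  have hinv : ∀ f : I ≃o I, f v = v → f⁻¹ v = v := fun f hf => by
    simpa using apply_zpow_eq_of_fixed hf (-1)
  obtain ⟨A₁, h1⟩ := hb x hzx hx
  obtain ⟨A₂, h2⟩ := hb y hzy hy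
  obtain ⟨A₃, h3⟩ := hb x⁻¹ hzx.inv_right (hinv x hx)
  obtain ⟨A₄, h4⟩ := hb y⁻¹ hzy.inv_right (hinv y hy)
  set n : ℕ := A₁ + A₂ + A₃ + A₄ + 1 with hn
  have e1 := pow_mul_eq_mul_pow_mul_zpow hxy hzx n
  have e2 : y * x ^ n = x ^ n * y * z ^ (-(N * n)) := by
    rw [e1, mul_assoc, ← zpow_add, add_neg_cancel, zpow_zero, mul_one]
  have e3 := pow_mul_eq_mul_pow_mul_zpow e2 hzy n
  have e4 : z ^ (N * n * n) = x⁻¹ ^ n * (y⁻¹ ^ n * (x ^ n * y ^ n)) := by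
    have e5 : x ^ n * y ^ n = y ^ n * x ^ n * z ^ (N * n * n) := by
      rw [e3, mul_assoc, ← zpow_add]
      simp
    rw [e5, inv_pow, inv_pow]
    group
  have h := pow_apply_le hzx.inv_right h3 (pow_apply_le hzy.inv_right h4
    (pow_apply_le hzx h1 (pow_apply_le hzy h2 (k := 0) (r := p) (by simp) n) n) n) n
  rw [← RelIso.mul_apply, ← RelIso.mul_apply, ← RelIso.mul_apply, mul_assoc, mul_assoc, ← e4,
    ← zpow_natCast] at h
  have h' := (zpow_apply_strictMono hp).le_iff_le.1 h
  push_cast at h'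
  have hn' : (n : ℤ) = A₁ + A₂ + A₃ + A₄ + 1 := by rw [hn]; push_cast; ring
  have hn0 : (0 : ℤ) < n := by omega
  nlinarith [mul_le_mul_of_nonneg_right (show (1 : ℤ) ≤ N by omega)
    (mul_nonneg hn0.le hn0.le)]

/-- There is no action of the Heisenberg group on an interval for which the center acts without
fixed points. -/
theorem false_of_commutator_eq_zpow {z x y : I ≃o I} {v w p : I} (hv : IsFreeInterval z v w)
    (hvp : v < p) (hpw : p < w) (hp : p < z p) (hzx : Commute z x) (hzy : Commute z y)
    (hx : x v = v) (hy : y v = v) {N : ℤ} (hN : N ≠ 0) (hxy : x * y = y * x * z ^ N) : False := by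
  rcases lt_or_gt_of_ne hN with h | h
  · refine false_of_commutator_eq_pow hv hvp hpw hp hzy hzx hy hx (neg_pos.2 h) ?_
    rw [hxy, mul_assoc, ← zpow_add, add_neg_cancel, zpow_zero, mul_one]
  · exact false_of_commutator_eq_pow hv hvp hpw hp hzx hzy hx hy h hxy

/-! ### Coordinates on `N4`. -/

theorem N4.ext {A B : N4} (h : ∀ i j, j < i → A.1.1 i j = B.1.1 i j) : A = B := by
  refine Subtype.ext (Units.ext (Matrix.ext fun i j => ?_))
  rcases lt_trichotomy i j with hij | rfl | hij
  · rw [A.2.2 i j hij, B.2.2 i j hij]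
  · rw [A.2.1, B.2.1]
  · exact h i j hij

theorem N4.ext_iff_entries {A B : N4} : A = B ↔ A.1.1 1 0 = B.1.1 1 0 ∧ A.1.1 2 1 = B.1.1 2 1 ∧
    A.1.1 3 2 = B.1.1 3 2 ∧ A.1.1 2 0 = B.1.1 2 0 ∧ A.1.1 3 1 = B.1.1 3 1 ∧
    A.1.1 3 0 = B.1.1 3 0 := by
  refine ⟨by rintro rfl; simp, fun ⟨h1, h2, h3, h4, h5, h6⟩ => N4.ext fun i j hij => ?_⟩
  fin_cases i <;> fin_cases j <;> first | assumption | exact absurd hij (by decide)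

namespace N4

theorem exists_entries (x y w p q r : ℤ) :
    ∃ A : N4, A.1.1 = !![1, 0, 0, 0; x, 1, 0, 0; p, y, 1, 0; r, q, w, 1] := by
  obtain ⟨A, hA, h⟩ := exists_mem_N4 !![1, 0, 0, 0; x, 1, 0, 0; p, y, 1, 0; r, q, w, 1]
    (by intro i; fin_cases i <;> rfl)
    (by intro i j h; fin_cases i <;> fin_cases j <;> first | rfl | exact absurd h (by decide))
  exact ⟨⟨A, hA⟩, h⟩

/-- The element of `N₄` with the given entries below the diagonal. -/
noncomputable def mk (x y w p q r : ℤ) : N4 := Classical.choose (exists_entries x y w p q r)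

theorem mk_val (x y w p q r : ℤ) :
    (mk x y w p q r).1.1 = !![1, 0, 0, 0; x, 1, 0, 0; p, y, 1, 0; r, q, w, 1] :=
  Classical.choose_spec (exists_entries x y w p q r)

theorem eq_mk (A : N4) : A = mk (A.1.1 1 0) (A.1.1 2 1) (A.1.1 3 2) (A.1.1 2 0) (A.1.1 3 1)
    (A.1.1 3 0) := by
  rw [N4.ext_iff_entries, mk_val]
  simp

theorem mk_mul (x y w p q r x' y' w' p' q' r' : ℤ) :
    mk x y w p q r * mk x' y' w' p' q' r' =
      mk (x + x') (y + y') (w + w') (p + p' + y * x') (q + q' + w * y')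
        (r + r' + q * x' + w * p') := by
  rw [N4.ext_iff_entries]
  simp only [Subgroup.coe_mul, Units.val_mul, mk_val, Matrix.mul_apply, Fin.sum_univ_four]
  refine ⟨?_, ?_, ?_, ?_, ?_, ?_⟩ <;> simp <;> ring

theorem mk_inj {x y w p q r x' y' w' p' q' r' : ℤ} :
    mk x y w p q r = mk x' y' w' p' q' r' ↔
      x = x' ∧ y = y' ∧ w = w' ∧ p = p' ∧ q = q' ∧ r = r' := by
  rw [N4.ext_iff_entries, mk_val, mk_val]
  simp

theorem exists_eq_mk (A : N4) : ∃ x y w p q r, A = mk x y w p q r := ⟨_, _, _, _, _, _, eq_mk A⟩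

theorem mk_zero : mk 0 0 0 0 0 0 = 1 := by
  have h := mk_mul 0 0 0 0 0 0 0 0 0 0 0 0
  simp at h
  exact h

theorem center_zpow (m n : ℤ) : mk 0 0 0 0 0 m ^ n = mk 0 0 0 0 0 (m * n) := by
  induction n using Int.induction_on with
  | zero => rw [zpow_zero, mul_zero, mk_zero]
  | succ n ih => rw [zpow_add_one, ih, mk_mul, mk_inj]; simp [mul_add]
  | pred n ih => rw [zpow_sub_one, ih, mul_inv_eq_iff_eq_mul, mk_mul, mk_inj]; simp [mul_sub]

theorem center_commute (m : ℤ) (A : N4) : Commute (mk 0 0 0 0 0 m) A := by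
  obtain ⟨x, y, w, p, q, r, rfl⟩ := exists_eq_mk A
  rw [commute_iff_eq, mk_mul, mk_mul, mk_inj]
  simp [add_comm]

/-- The abelianization of `N₄`. -/
noncomputable def coords : N4 →* Multiplicative (ℤ × ℤ × ℤ) where
  toFun A := Multiplicative.ofAdd (A.1.1 1 0, A.1.1 2 1, A.1.1 3 2)
  map_one' := by rw [← mk_zero, mk_val]; rfl
  map_mul' A B := by
    obtain ⟨x, y, w, p, q, r, rfl⟩ := exists_eq_mk A
    obtain ⟨x', y', w', p', q', r', rfl⟩ := exists_eq_mk B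
    rw [mk_mul, mk_val, mk_val, mk_val]
    rfl

theorem exists_eq_mk_of_word (x y w p q r x' y' w' p' q' r' : ℤ) (i j i' j' : ℕ) :
    ∃ P Q R : ℤ, (mk x y w p q r ^ i' * mk x' y' w' p' q' r' ^ j')⁻¹ *
      (mk x y w p q r ^ i * mk x' y' w' p' q' r' ^ j) =
      mk ((i - i') * x + (j - j') * x') ((i - i') * y + (j - j') * y')
        ((i - i') * w + (j - j') * w') P Q R := by
  obtain ⟨a, b, c, P, Q, R, h⟩ := exists_eq_mk ((mk x y w p q r ^ i' * mk x' y' w' p' q' r' ^ j')⁻¹ *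
      (mk x y w p q r ^ i * mk x' y' w' p' q' r' ^ j))
  have hc : ∀ x y w p q r : ℤ, coords (mk x y w p q r) = Multiplicative.ofAdd (x, y, w) := by
    intro x y w p q r
    change Multiplicative.ofAdd _ = _
    rw [mk_val]
    rfl
  have h' := congrArg coords h
  simp only [map_mul, map_inv, map_pow, hc, ← ofAdd_nsmul, ← ofAdd_add, ← ofAdd_neg,
    EmbeddingLike.apply_eq_iff_eq, Prod.mk.injEq, Prod.smul_mk, Prod.mk_add_mk, Prod.neg_mk,
    nsmul_eq_mul] at h'
  obtain ⟨h1, h2, h3⟩ := h'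
  refine ⟨P, Q, R, ?_⟩
  rw [h, mk_inj]
  refine ⟨?_, ?_, ?_, rfl, rfl, rfl⟩
  · rw [← h1]; ring
  · rw [← h2]; ring
  · rw [← h3]; ring

end N4

/-! ### Finding a grid, or a Heisenberg pair in the stabilizer. -/

/-- The data of an action of `N₄` by diffeomorphisms, with a component `(v, w)` of the complement
of the fixed points of a generator of the center. -/
structure CentralInterval (α : ℝ≥0) (Φ : N4 →* (I ≃o I)) (ε : ℤ) (v w p : I) : Prop where
  smooth : ∀ A, IsDiffHolder α (Φ A)
  sq : ε * ε = 1
  isFree : IsFreeInterval (Φ (N4.mk 0 0 0 0 0 ε)) v w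
  left_lt : v < p
  lt_right : p < w
  lt_apply : p < Φ (N4.mk 0 0 0 0 0 ε) p

namespace CentralInterval

variable {α : ℝ≥0} {Φ : N4 →* (I ≃o I)} {ε : ℤ} {v w p : I}

theorem map_mul_center (h : CentralInterval α Φ ε v w p) {A B : N4} {k : ℤ}
    (hAB : A * B = B * A * N4.mk 0 0 0 0 0 k) :
    Φ A * Φ B = Φ B * Φ A * Φ (N4.mk 0 0 0 0 0 ε) ^ (ε * k) := by
  rw [← map_zpow, N4.center_zpow, ← mul_assoc, h.sq, one_mul, ← map_mul, hAB, map_mul, map_mul]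

theorem not_heisenberg (h : CentralInterval α Φ ε v w p) {A B : N4} {k : ℤ} (hk : k ≠ 0)
    (hA : Φ A v = v) (hB : Φ B v = v) : A * B ≠ B * A * N4.mk 0 0 0 0 0 k := fun hAB =>
  have hε : ε ≠ 0 := by rintro rfl; simpa using h.sq
  false_of_commutator_eq_zpow h.isFree h.left_lt h.lt_right h.lt_apply
    ((N4.center_commute ε A).map Φ) ((N4.center_commute ε B).map Φ) hA hB
    (mul_ne_zero hε hk) (h.map_mul_center hAB)

theorem false_of_word_free (h : CentralInterval α Φ ε v w p) (hα : 1 / 2 < α) {s t u : N4}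
    {k c : ℤ} (hc : c ≠ 0) (hst : s * t = t * s * N4.mk 0 0 0 0 0 k)
    (hsu : s * u = u * s * N4.mk 0 0 0 0 0 c) (htu : Commute t u)
    (hfree : ∀ i j i' j' : ℕ, Φ ((s ^ i' * t ^ j')⁻¹ * (s ^ i * t ^ j)) v = v →
      i = i' ∧ j = j') : False := by
  have hε : ε ≠ 0 := by rintro rfl; simpa using h.sq
  have hα' : (1 / 2 : ℝ) < α := by exact_mod_cast hα
  -- The cap 3/4 only serves to keep the exponent below 1.
  have hβ : (1 / 2 : ℝ) < min (α : ℝ) (3 / 4) := lt_min hα' (by norm_num)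
  have hβ1 : min (α : ℝ) (3 / 4) < 1 := (min_le_right _ _).trans_lt (by norm_num)
  have hβ0 : (0 : ℝ) < min (α : ℝ) (3 / 4) := lt_trans (by norm_num) hβ
  obtain ⟨C₁, h1⟩ := (h.smooth s).exists_holderDistortion hβ0 (min_le_left _ _)
  obtain ⟨C₂, h2⟩ := (h.smooth t).exists_holderDistortion hβ0 (min_le_left _ _)
  obtain ⟨K, hK, hu⟩ := (h.smooth u).exists_lipschitz
  obtain ⟨K', hK', hu'⟩ := (h.smooth u⁻¹).exists_lipschitz
  rw [map_inv] at hu'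
  refine false_of_grid h.isFree h.left_lt h.lt_right h.lt_apply
    ((N4.center_commute ε s).map Φ) ((N4.center_commute ε t).map Φ)
    ((N4.center_commute ε u).map Φ) (mul_ne_zero hε hc) (h.map_mul_center hst)
    (h.map_mul_center hsu) (htu.map Φ) (C := max 0 (max C₁ C₂)) hβ hβ1
    (h1.mono ((le_max_left _ _).trans (le_max_right _ _)))
    (h2.mono ((le_max_right _ _).trans (le_max_right _ _))) (le_max_left _ _) hK hK' hu hu' ?_
  intro i j i' j' he
  apply hfree
  rw [map_mul, map_inv, RelIso.mul_apply]
  simp only [map_mul, map_pow]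
  rw [he, RelIso.inv_apply_self]

/-- The stabilizer of `v` contains no elements over nonzero multiples of all of `(1, 0, 0)`,
`(1, 1, 0)` and `(0, 0, 1)` in the abelianization. -/
theorem stabilizer_small (h : CentralInterval α Φ ε v w p) {i j k p₁ q₁ r₁ p₂ q₂ r₂ p₃ q₃ r₃ : ℤ}
    (hi : i ≠ 0) (hj : j ≠ 0) (hk : k ≠ 0) (h1 : Φ (N4.mk i 0 0 p₁ q₁ r₁) v = v)
    (h2 : Φ (N4.mk k k 0 p₂ q₂ r₂) v = v) (h3 : Φ (N4.mk 0 0 j p₃ q₃ r₃) v = v) : False := by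
  -- The commutator of the first two elements has `-(k * i)` as its only nonzero entry apart from
  -- the central one. With the third element it forms a Heisenberg pair.
  obtain ⟨x, y, z, P, Q, R, hP⟩ := N4.exists_eq_mk
    ((N4.mk k k 0 p₂ q₂ r₂ * N4.mk i 0 0 p₁ q₁ r₁)⁻¹ *
      (N4.mk i 0 0 p₁ q₁ r₁ * N4.mk k k 0 p₂ q₂ r₂))
  have hfix : Φ (N4.mk x y z P Q R) v = v := by
    apply (Φ (N4.mk k k 0 p₂ q₂ r₂ * N4.mk i 0 0 p₁ q₁ r₁)).injective
    rw [← RelIso.mul_apply, ← map_mul, ← hP, mul_inv_cancel_left, map_mul, map_mul,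
      RelIso.mul_apply, RelIso.mul_apply, h1, h2, h1]
  rw [inv_mul_eq_iff_eq_mul, N4.mk_mul, N4.mk_mul, N4.mk_mul, N4.mk_inj] at hP
  obtain ⟨e1, e2, e3, e4, e5, -⟩ := hP
  obtain rfl : x = 0 := by linarith
  obtain rfl : y = 0 := by linarith
  obtain rfl : z = 0 := by linarith
  obtain rfl : P = -(k * i) := by linarith
  obtain rfl : Q = 0 := by linarith
  refine h.not_heisenberg (k := j * (k * i)) (by positivity) hfix h3 ?_
  rw [N4.mk_mul, N4.mk_mul, N4.mk_mul, N4.mk_inj]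
  refine ⟨?_, ?_, ?_, ?_, ?_, ?_⟩ <;> ring

/-- The hypotheses make the grid free: `hs` forces equal exponents of `s`, and then a power of `t`
fixes `v`, hence has exponent 0 since `t` moves `v`. -/
theorem false_of_small (h : CentralInterval α Φ ε v w p) (hα : 1 / 2 < α) {x y z c : ℤ}
    {u : N4} (hc : c ≠ 0)
    (hsu : N4.mk x y z 0 0 0 * u = u * N4.mk x y z 0 0 0 * N4.mk 0 0 0 0 0 c)
    {p₁ q₁ : ℤ} (hu : Commute (N4.mk 0 0 0 p₁ q₁ 0) u) (ht : Φ (N4.mk 0 0 0 p₁ q₁ 0) v ≠ v)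
    (hs : ∀ i P Q R : ℤ, Φ (N4.mk (i * x) (i * y) (i * z) P Q R) v = v → i = 0) : False := by
  refine h.false_of_word_free hα (s := N4.mk x y z 0 0 0) (t := N4.mk 0 0 0 p₁ q₁ 0)
    (k := z * p₁ - q₁ * x) hc ?_ hsu hu ?_
  · rw [N4.mk_mul, N4.mk_mul, N4.mk_mul, N4.mk_inj]
    refine ⟨?_, ?_, ?_, ?_, ?_, ?_⟩ <;> ring
  · intro i j i' j' hw
    obtain ⟨P, Q, R, he⟩ := N4.exists_eq_mk_of_word x y z 0 0 0 0 0 0 p₁ q₁ 0 i j i' j'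
    have hw' := hw
    rw [he] at hw'
    simp only [mul_zero, add_zero] at hw'
    have h0 : i = i' := by
      have := hs _ _ _ _ hw'
      omega
    subst h0
    refine ⟨rfl, ?_⟩
    by_contra hne
    refine ht (zpow_fixed_imp_fixed (n := (j : ℤ) - j') (by omega) ?_)
    rw [← map_zpow]
    convert hw using 3
    rw [mul_inv_rev, mul_assoc, inv_mul_cancel_left, sub_eq_neg_add, zpow_add, zpow_neg,
      zpow_natCast, zpow_natCast]

theorem false (h : CentralInterval α Φ ε v w p) (hα : 1 / 2 < α) : False := by
  by_cases hcase : Φ (N4.mk 0 0 0 1 0 0) v = v ∧ Φ (N4.mk 0 0 0 0 1 0) v = v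
  -- Each element on the second subdiagonal detects one exponent: a word fixing `v` with a nonzero
  -- exponent would form a Heisenberg pair with it.
  · refine h.false_of_word_free hα (s := N4.mk 0 0 1 0 0 0) (t := N4.mk 1 0 0 0 0 0)
      (u := N4.mk 0 0 0 1 0 0) (k := 0) (c := 1) one_ne_zero ?_ ?_ ?_ ?_
    · simp [N4.mk_mul]
    · simp [N4.mk_mul]
    · simp [commute_iff_eq, N4.mk_mul]
    · intro i j i' j' hw
      obtain ⟨P, Q, R, he⟩ := N4.exists_eq_mk_of_word 0 0 1 0 0 0 1 0 0 0 0 0 i j i' j'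
      rw [he] at hw
      simp only [mul_zero, add_zero, mul_one, zero_add] at hw
      constructor
      · by_contra hne
        refine h.not_heisenberg (k := (i : ℤ) - i') (by omega) hw hcase.1 ?_
        rw [N4.mk_mul, N4.mk_mul, N4.mk_mul, N4.mk_inj]
        refine ⟨?_, ?_, ?_, ?_, ?_, ?_⟩ <;> ring
      · by_contra hne
        refine h.not_heisenberg (k := -((j : ℤ) - j')) (by omega) hw hcase.2 ?_
        rw [N4.mk_mul, N4.mk_mul, N4.mk_mul, N4.mk_inj]
        refine ⟨?_, ?_, ?_, ?_, ?_, ?_⟩ <;> ring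
  · obtain ⟨p₁, q₁, ht⟩ : ∃ p₁ q₁, Φ (N4.mk 0 0 0 p₁ q₁ 0) v ≠ v := by
      by_contra! hall
      exact hcase ⟨hall 1 0, hall 0 1⟩
    have hcomm : ∀ p₂ q₂, Commute (N4.mk 0 0 0 p₁ q₁ 0) (N4.mk 0 0 0 p₂ q₂ 0) := fun p₂ q₂ => by
      simp [commute_iff_eq, N4.mk_mul, add_comm]
    have hs : ∀ x y z c p₂ q₂ : ℤ, c ≠ 0 →
        N4.mk x y z 0 0 0 * N4.mk 0 0 0 p₂ q₂ 0 =
          N4.mk 0 0 0 p₂ q₂ 0 * N4.mk x y z 0 0 0 * N4.mk 0 0 0 0 0 c →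
        ∃ i P Q R : ℤ, i ≠ 0 ∧ Φ (N4.mk (i * x) (i * y) (i * z) P Q R) v = v := by
      intro x y z c p₂ q₂ hc hsu
      by_contra! hall
      exact h.false_of_small hα hc hsu (hcomm p₂ q₂) ht fun i P Q R hw =>
        by_contra fun hi => hall i P Q R hi hw
    -- The direction `(1, 1, 0)` replaces `(0, 1, 0)`, which commutes with the whole second
    -- subdiagonal and so admits no `u`.
    obtain ⟨i, P₁, Q₁, R₁, hi, h1⟩ := hs 1 0 0 (-1) 0 1 (by norm_num) (by simp [N4.mk_mul])
    obtain ⟨k, P₂, Q₂, R₂, hk, h2⟩ := hs 1 1 0 (-1) 0 1 (by norm_num) (by simp [N4.mk_mul])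
    obtain ⟨j, P₃, Q₃, R₃, hj, h3⟩ := hs 0 0 1 1 1 0 (by norm_num) (by simp [N4.mk_mul])
    simp only [mul_one, mul_zero] at h1 h2 h3
    exact h.stabilizer_small hi hj hk h1 h2 h3

end CentralInterval

theorem theoremB (α : ℝ≥0) (hα : 1 / 2 < α) :
    ¬ ∃ φ : N4 →* DiffPlus α, Function.Injective φ := by
  rintro ⟨φ, hφ⟩
  set Φ : N4 →* (I ≃o I) := (DiffPlus α).subtype.comp φ with hΦ
  have hinj : Function.Injective Φ := Subtype.val_injective.comp hφ
  have hsm : ∀ A, IsDiffHolder α (Φ A) := fun A => (φ A).2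
  have hne : Φ (N4.mk 0 0 0 0 0 1) ≠ 1 := fun h => by
    rw [← map_one Φ] at h
    have := hinj h
    rw [← N4.mk_zero, N4.mk_inj] at this
    simp at this
  obtain ⟨p, hp⟩ : ∃ p, Φ (N4.mk 0 0 0 0 0 1) p ≠ p := by
    by_contra! h
    exact hne (RelIso.ext h)
  have hinv : Φ (N4.mk 0 0 0 0 0 (-1)) = (Φ (N4.mk 0 0 0 0 0 1))⁻¹ := by
    rw [← map_inv, ← zpow_neg_one, N4.center_zpow, one_mul]
  -- The sign of the central generator is chosen so that it moves `p` upwards.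
  rcases lt_or_gt_of_ne hp with hlt | hlt
  · have hlt' : p < Φ (N4.mk 0 0 0 0 0 (-1)) p := by
      rw [hinv, ← OrderIso.lt_iff_lt (Φ (N4.mk 0 0 0 0 0 1)), RelIso.apply_inv_self]
      exact hlt
    obtain ⟨v, w, hv, h1, h2⟩ := exists_isFreeInterval hlt'.ne'
    exact CentralInterval.false ⟨hsm, by norm_num, hv, h1, h2, hlt'⟩ hα
  · obtain ⟨v, w, hv, h1, h2⟩ := exists_isFreeInterval hlt.ne'
    exact CentralInterval.false ⟨hsm, by norm_num, hv, h1, h2, hlt⟩ hα
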